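/- Let $2\le d<N$, let $x_1,\dots,x_N\in\mathbb R^d$, and put $R=\max_i\|x_i\|_2$, $X_D=\{x_i:i\in D\}$ for $D\subseteq[N]$, and $X=X_{[N]}$. Suppose that $\operatorname{conv}(X_D)$ has nonempty interior for every $D\subseteq[N]$ with $|D|>d$. The curvature of $x_i$ is $$\kappa(x_i)=\frac{|V_i|}{|\mathbb S^{d-1}|},\qquad V_i=\{v\in\mathbb S^{d-1}:\ v^Tx_i\ge v^Tx_j\ \text{for all } j\in[N]\},$$ where $|\cdot|$ is the surface measure of the unit sphere $\mathbb S^{d-1}$. Let $\kappa_1\ge\kappa_2\ge\dots\ge\kappa_N$ be the numbers $\kappa(x_1),\dots,\kappa(x_N)$ in decreasing order, and $\kappa_{N+1}=0$. For $\eta>0$ and $M\in\mathbb N$ consider the following algorithm. Draw $v_1,\dots,v_M$ independently and uniformly from $\mathbb S^{d-1}$. For each $i\in[M]$ choose $u_i\in\arg\max_{j\in[N]}v_i^Tx_j$, and let $e_j=|\{i\in[M]:u_i=j\}|$ for $j\in[N]$. List the indices as $\ell_1,\dots,\ell_N$ with $e_{\ell_1}\ge\dots\ge e_{\ell_N}$,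 put $$L=\max\Bigl\{\min\Bigl\{\ell:\ \tfrac1M\sum_{j=1}^{\ell}e_{\ell_j}>1-\tfrac{\eta}{3}\Bigr\},\ d+1\Bigr\},$$ and return $T=\{\ell_1,\dots,\ell_L\}$. Ties in the maximization and in the sorting are broken arbitrarily. Let $q$ be the smallest integer $j\ge1$ such that $\sum_{i=1}^{j}\kappa_i\ge1-\eta/18$, and suppose that $\Delta:=\kappa_q-\kappa_{q+1}>0$. Let $\delta>0$. If $$M\ge\max\Bigl\{\frac{324q^2}{\eta^2},\frac{4}{\Delta^2}\Bigr\}\log\Bigl(\frac{3N}{\sqrt\delta}\Bigr),$$ then with probability at least $1-\delta$, whatever the way in which ties are broken, $$|T|\le\max\{q,d+1\}\quad\text{and}\quad d_H\bigl(\operatorname{conv}(X_T),\operatorname{conv}(X)\bigr)\le\min\bigl\{\sqrt2\,\pi\,\eta^{1/(d-1)},2\bigr\}\cdot R,$$ where $d_H$ is the Hausdorff distance. -/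

import Mathlib

open MeasureTheory ProbabilityTheory

namespace ApproxHull

/-- The uniform probability measure on the unit sphere of `ℝ^d`: normalized surface measure. -/
noncomputable def uniformSphere (d : ℕ) :
    Measure (Metric.sphere (0 : EuclideanSpace ℝ (Fin d)) 1) :=
  ((volume : Measure (EuclideanSpace ℝ (Fin d))).toSphere Set.univ)⁻¹ •
    (volume : Measure (EuclideanSpace ℝ (Fin d))).toSphere

/-- The unit directions `v` in which `x i` is a maximizer of `⟨v, x j⟩` over all data points. -/
def normalDirections {d N : ℕ} (x : Fin N → EuclideanSpace ℝ (Fin d)) (i : Fin N) :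
    Set (Metric.sphere (0 : EuclideanSpace ℝ (Fin d)) 1) :=
  {v | ∀ j, inner ℝ (v : EuclideanSpace ℝ (Fin d)) (x j) ≤
    inner ℝ (v : EuclideanSpace ℝ (Fin d)) (x i)}

/-- The curvature of the data point `x i`: the fraction of the unit sphere covered by its
normal directions. (If the data points are distinct and `x i` is not an extreme point of the hull,
then it is `0`.) -/
noncomputable def curvature {d N : ℕ} (x : Fin N → EuclideanSpace ℝ (Fin d)) (i : Fin N) : ℝ :=
  (uniformSphere d).real (normalDirections x i)

/-- The curvatures in decreasing order, `sortedCurvature x 0 ≥ sortedCurvature x 1 ≥ ⋯`,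
so that the `k`-th largest one is `sortedCurvature x (k - 1)`; continued by `0` after the `N`-th. -/
noncomputable def sortedCurvature {d N : ℕ} (x : Fin N → EuclideanSpace ℝ (Fin d)) (k : ℕ) : ℝ :=
  if h : k < N then
    curvature x (Tuple.sort (fun i => -curvature x i) ⟨k, h⟩)
  else 0

/-- The counter `e_j` at the end of the loop: how often the index `j` was selected. -/
def hitCount {N M : ℕ} (u : Fin M → Fin N) (j : Fin N) : ℕ :=
  (Finset.univ.filter fun i => u i = j).card

/-- The number `L` of points that are kept, given an enumeration `σ` of the indices by decreasing
counters: the least `ℓ` such that the first `ℓ` estimated curvatures `e_j / M` sum to more than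
`1 - η / 3`, or `d + 1` if that is larger. -/
noncomputable def cutoff {N M : ℕ} (d : ℕ) (η : ℝ) (u : Fin M → Fin N)
    (σ : Equiv.Perm (Fin N)) : ℕ :=
  max (sInf {ℓ : ℕ | 1 - η / 3 <
    (1 / (M : ℝ)) * ∑ j ∈ Finset.univ.filter (fun j : Fin N => (j : ℕ) < ℓ),
      (hitCount u (σ j) : ℝ)}) (d + 1)

/-- `T` is a possible result of the algorithm on the data `x` with accuracy `η` when the sampled
directions are `v 0, …, v (M - 1)`: `u i` is an index of a maximizer of `⟨v i, x j⟩`, `σ` lists the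
indices by decreasing counters, and `T` consists of the first `L` of them.
Ties in the maximization and in the sorting may be broken in any way. -/
def IsOutput {d N M : ℕ} (x : Fin N → EuclideanSpace ℝ (Fin d)) (η : ℝ)
    (v : Fin M → Metric.sphere (0 : EuclideanSpace ℝ (Fin d)) 1) (T : Finset (Fin N)) : Prop :=
  ∃ (u : Fin M → Fin N) (σ : Equiv.Perm (Fin N)),
    (∀ i, v i ∈ normalDirections x (u i)) ∧
    Antitone (fun j => hitCount u (σ j)) ∧
    T = (Finset.univ.filter fun j : Fin N => (j : ℕ) < cutoff d η u σ).map σ.toEmbedding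

end ApproxHull

/-!
If a point of `conv X` lies at distance `r` from `conv X_T`, separation gives a unit direction `w`
in which some `x i` exceeds every point of `X_T` by `r`. Since `‖x j‖ ≤ R`, no direction within
angle `arcsin (r / 2R)` of `w` has a maximizer in `T`, so the points of `T` miss a spherical cap,
and their total curvature is at most `1` minus its measure. That measure is at least
`7/18 (√2 s / π)^(d-1)`, with `s = r / 2R`, because the cone over the cap contains a flattened
ball. On the other hand, Hoeffding's inequality and a union bound put all empirical frequencies
within `η / (18 q)` of the curvatures, which makes the cutoff stop at `max q (d + 1)` at the latest
and leaves the kept points with total curvature at least `1 - 7 η / 18`.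
-/

namespace ApproxHull

open Metric Module
open scoped Pointwise RealInnerProductSpace

section SphericalCap

variable {E : Type*} [NormedAddCommGroup E] [InnerProductSpace ℝ E]

/-- The open cap of angular radius `arcsin s` around the unit vector `w`, for `0 ≤ s ≤ 1`. -/
def sphericalCap (w : E) (s : ℝ) : Set (sphere (0 : E) 1) :=
  {v | √(1 - s ^ 2) < ⟪w, v⟫}

lemma isOpen_sphericalCap (w : E) (s : ℝ) : IsOpen (sphericalCap w s) :=
  isOpen_lt continuous_const (by fun_prop)

/-- The angle between `v` and `w` is less than `arcsin s`, the one between `w` and `z` is at most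
`arccos s`, and these two bounds add up to a right angle. -/
lemma inner_pos_of_mem_sphericalCap {w : E} (hw : ‖w‖ = 1) {s : ℝ} (hs : 0 ≤ s)
    {v : sphere (0 : E) 1} (hv : v ∈ sphericalCap w s) {z : E} (hwz : 0 < ⟪w, z⟫)
    (hsz : s * ‖z‖ ≤ ⟪w, z⟫) : 0 < ⟪(v : E), z⟫ := by
  have hv1 : ‖(v : E)‖ = 1 := norm_eq_of_mem_sphere v
  have hz : 0 < ‖z‖ := norm_pos_iff.2 fun h => by simp [h] at hwz
  have hvw : InnerProductGeometry.angle (v : E) w < Real.arcsin s := by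
    rw [InnerProductGeometry.angle_comm, InnerProductGeometry.angle, hw, hv1, one_mul, div_one,
      Real.arcsin_eq_arccos hs]
    refine Real.arccos_lt_arccos (by linarith [Real.sqrt_nonneg (1 - s ^ 2)]) hv ?_
    simpa [hw, hv1] using real_inner_le_norm w v
  have hwz' : InnerProductGeometry.angle w z ≤ Real.pi / 2 - Real.arcsin s := by
    rw [InnerProductGeometry.angle, hw, one_mul, ← Real.arccos_eq_pi_div_two_sub_arcsin]
    exact Real.arccos_le_arccos ((le_div_iff₀ hz).2 hsz)
  have hvz : InnerProductGeometry.angle (v : E) z < Real.pi / 2 := by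
    linarith [InnerProductGeometry.angle_le_angle_add_angle (v : E) w z]
  rw [← InnerProductGeometry.cos_angle_mul_norm_mul_norm, hv1, one_mul]
  exact mul_pos (Real.cos_pos_of_mem_Ioo
    ⟨by linarith [Real.pi_pos, InnerProductGeometry.angle_nonneg (v : E) z], hvz⟩) hz

lemma mem_Ioo_smul_image_sphericalCap {w y : E} {s : ℝ} (hy : ‖y‖ < 1)
    (hwy : √(1 - s ^ 2) * ‖y‖ < ⟪w, y⟫) :
    y ∈ Set.Ioo (0 : ℝ) 1 • ((↑) '' sphericalCap w s : Set E) := by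
  have hy0 : 0 < ‖y‖ := norm_pos_iff.2 fun h => by simp [h] at hwy
  have hunit : ‖y‖⁻¹ • y ∈ sphere (0 : E) 1 := by
    simp [norm_smul, hy0.ne']
  have hcap : (⟨‖y‖⁻¹ • y, hunit⟩ : sphere (0 : E) 1) ∈ sphericalCap w s := by
    change √(1 - s ^ 2) < ⟪w, ‖y‖⁻¹ • y⟫
    rwa [real_inner_smul_right, ← div_eq_inv_mul, lt_div_iff₀ hy0]
  exact Set.mem_smul.2
    ⟨‖y‖, ⟨hy0, hy⟩, ‖y‖⁻¹ • y, ⟨_, hcap, rfl⟩, smul_inv_smul₀ hy0.ne' y⟩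

end SphericalCap

section AxialScaling

variable {E : Type*} [NormedAddCommGroup E] [InnerProductSpace ℝ E] {w : E} {c ρ s : ℝ}

/-- For a unit vector `w`, the linear map that fixes `w` and multiplies the vectors orthogonal to it
by `c`. It flattens balls centred on the axis `ℝ w` into ellipsoids that fit into narrow cones. -/
noncomputable def axialScaling (w : E) (c : ℝ) : E →ₗ[ℝ] E :=
  c • LinearMap.id + (innerₛₗ ℝ w).smulRight ((1 - c) • w)

lemma axialScaling_apply (w : E) (c : ℝ) (z : E) :
    axialScaling w c z = c • z + ⟪w, z⟫ • (1 - c) • w := rfl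

lemma det_axialScaling [FiniteDimensional ℝ E] (hw : ‖w‖ = 1) (hc : c ≠ 0) :
    LinearMap.det (axialScaling w c) = c ^ (finrank ℝ E - 1) := by
  have hw0 : w ≠ 0 := norm_ne_zero_iff.1 (by simp [hw])
  have : Nontrivial E := ⟨w, 0, hw0⟩
  have htransvection : axialScaling w c =
      c • LinearMap.transvection (innerₛₗ ℝ w) (c⁻¹ • (1 - c) • w) := by
    ext z
    simp only [axialScaling_apply, LinearMap.smul_apply, LinearMap.transvection.apply, smul_add,
      innerₛₗ_apply_apply, smul_comm c ⟪w, z⟫, smul_inv_smul₀ hc]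
  obtain ⟨n, hn⟩ := Nat.exists_eq_add_of_le' (finrank_pos (R := ℝ) (M := E))
  rw [htransvection, LinearMap.det_smul, LinearMap.transvection.det, hn]
  simp only [innerₛₗ_apply_apply, real_inner_smul_right, real_inner_self_eq_norm_sq, hw]
  rw [Nat.add_sub_cancel, pow_succ]
  field_simp
  ring

lemma inner_axialScaling (hw : ‖w‖ = 1) (z : E) : ⟪w, axialScaling w c z⟫ = ⟪w, z⟫ := by
  simp only [axialScaling_apply, inner_add_right, real_inner_smul_right,
    real_inner_self_eq_norm_sq, hw]
  ring

lemma norm_sq_axialScaling (hw : ‖w‖ = 1) (z : E) :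
    ‖axialScaling w c z‖ ^ 2 = ⟪w, z⟫ ^ 2 + c ^ 2 * (‖z‖ ^ 2 - ⟪w, z⟫ ^ 2) := by
  rw [axialScaling_apply, norm_add_sq_real]
  simp only [norm_smul, real_inner_smul_left, real_inner_smul_right, real_inner_comm w z, hw,
    mul_pow, Real.norm_eq_abs, sq_abs]
  ring

lemma inner_sq_le_norm_sq (hw : ‖w‖ = 1) (z : E) : ⟪w, z⟫ ^ 2 ≤ ‖z‖ ^ 2 := by
  simpa [hw] using sq_le_sq' (neg_le_of_abs_le (abs_real_inner_le_norm w z))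
    (real_inner_le_norm w z)

lemma norm_axialScaling_le (hw : ‖w‖ = 1) (hc : |c| ≤ 1) (z : E) :
    ‖axialScaling w c z‖ ≤ ‖z‖ := by
  refine le_of_sq_le_sq ?_ (norm_nonneg z)
  rw [norm_sq_axialScaling hw]
  linarith [mul_le_of_le_one_left (sub_nonneg.2 (inner_sq_le_norm_sq hw z))
    ((sq_le_one_iff_abs_le_one c).2 hc)]

lemma two_mul_le_one_of_mul_add_le {k : ℝ} (hs : 0 < s) (hk : 0 ≤ k)
    (hρ : ρ ^ 2 * (s ^ 2 + k) ≤ (1 - ρ) ^ 2 * s ^ 2) : 2 * ρ ≤ 1 := by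
  have hsq : ρ ^ 2 ≤ (1 - ρ) ^ 2 :=
    le_of_mul_le_mul_right (by linarith [mul_nonneg (sq_nonneg ρ) hk]) (pow_pos hs 2)
  linarith

/-- Multiplying by `s² + k` turns the difference of the two sides into the square of
`(s² + k) a - k (1 - ρ)` plus a nonnegative multiple of the slack in `hρ`. -/
lemma mul_sub_sq_le_of_mul_add_le {k a : ℝ} (hs : 0 < s) (hk : 0 ≤ k)
    (hρ : ρ ^ 2 * (s ^ 2 + k) ≤ (1 - ρ) ^ 2 * s ^ 2) :
    k * (ρ ^ 2 - (a - (1 - ρ)) ^ 2) ≤ s ^ 2 * a ^ 2 := by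
  have hsk : 0 < s ^ 2 + k := by positivity
  refine le_of_mul_le_mul_left ?_ hsk
  linarith [sq_nonneg ((s ^ 2 + k) * a - k * (1 - ρ)), mul_le_mul_of_nonneg_left hρ hk]

/-- The condition `hρ` says that the flattened ball does not reach beyond the cone. -/
lemma sqrt_mul_norm_axialScaling_lt_inner (hw : ‖w‖ = 1) (hs : 0 < s) (hs1 : s ≤ 1)
    (hρ : ρ ^ 2 * (s ^ 2 + c ^ 2 * (1 - s ^ 2)) ≤ (1 - ρ) ^ 2 * s ^ 2) {p : E}
    (hp : p ∈ ball ((1 - ρ) • w) ρ) :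
    √(1 - s ^ 2) * ‖axialScaling w c p‖ < ⟪w, axialScaling w c p⟫ := by
  set a := ⟪w, p⟫ with ha
  set k := c ^ 2 * (1 - s ^ 2)
  have hs2 : 0 ≤ 1 - s ^ 2 := sub_nonneg.2 (pow_le_one₀ hs.le hs1)
  have hk0 : 0 ≤ k := by positivity
  have hdist : ‖p‖ ^ 2 - a ^ 2 + (a - (1 - ρ)) ^ 2 < ρ ^ 2 := by
    have hlt := pow_lt_pow_left₀ (mem_ball_iff_norm.1 hp) (norm_nonneg _) two_ne_zero
    rw [norm_sub_sq_real, real_inner_smul_right, real_inner_comm, norm_smul, hw, mul_one,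
      Real.norm_eq_abs, sq_abs, ← ha] at hlt
    linarith
  have ha0 : 0 < a := by
    have habs : |a - (1 - ρ)| < ρ := abs_lt_of_sq_lt_sq
      (by linarith [inner_sq_le_norm_sq hw p]) (dist_nonneg.trans_lt hp).le
    linarith [(abs_lt.1 habs).1, two_mul_le_one_of_mul_add_le hs hk0 hρ]
  have hcross : k * (‖p‖ ^ 2 - a ^ 2) < s ^ 2 * a ^ 2 := by
    rcases hk0.eq_or_lt with hk0 | hk0
    · rw [← hk0, zero_mul]
      positivity
    · exact (mul_lt_mul_of_pos_left (lt_sub_iff_add_lt.2 hdist) hk0).trans_le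
        (mul_sub_sq_le_of_mul_add_le hs hk0.le hρ)
  rw [inner_axialScaling hw, ← ha]
  refine lt_of_pow_lt_pow_left₀ 2 ha0.le ?_
  rw [mul_pow, Real.sq_sqrt hs2, norm_sq_axialScaling hw, ← ha]
  linarith

lemma axialScaling_image_ball_subset (hw : ‖w‖ = 1) (hs : 0 < s) (hs1 : s ≤ 1) (hc : |c| ≤ 1)
    (hρ : ρ ^ 2 * (s ^ 2 + c ^ 2 * (1 - s ^ 2)) ≤ (1 - ρ) ^ 2 * s ^ 2) :
    axialScaling w c '' ball ((1 - ρ) • w) ρ ⊆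
      Set.Ioo (0 : ℝ) 1 • ((↑) '' sphericalCap w s : Set E) := by
  rintro _ ⟨p, hp, rfl⟩
  refine mem_Ioo_smul_image_sphericalCap ((norm_axialScaling_le hw hc p).trans_lt ?_)
    (sqrt_mul_norm_axialScaling_lt_inner hw hs hs1 hρ hp)
  have hρ1 : 2 * ρ ≤ 1 := two_mul_le_one_of_mul_add_le hs
    (mul_nonneg (sq_nonneg c) (sub_nonneg.2 (pow_le_one₀ hs.le hs1))) hρ
  have hcenter : ‖(1 - ρ) • w‖ = 1 - ρ := by
    rw [norm_smul, hw, mul_one, Real.norm_of_nonneg (by linarith [dist_nonneg.trans_lt hp])]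
  linarith [norm_le_norm_add_norm_sub' p ((1 - ρ) • w), mem_ball_iff_norm.1 hp]

end AxialScaling

section UniformSphere

variable {d : ℕ}

instance : IsZeroOrProbabilityMeasure (uniformSphere d) := by
  unfold uniformSphere
  infer_instance

lemma uniformSphere_mul_volume_ball {S : Set (sphere (0 : EuclideanSpace ℝ (Fin d)) 1)}
    (hS : MeasurableSet S) :
    uniformSphere d S * volume (ball (0 : EuclideanSpace ℝ (Fin d)) 1) =
      volume (Set.Ioo (0 : ℝ) 1 • ((↑) '' S : Set (EuclideanSpace ℝ (Fin d)))) := by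
  obtain rfl | hd := eq_or_ne d 0
  · obtain rfl : S = ∅ := Set.eq_empty_of_isEmpty S
    simp
  have hmass : (d * volume (ball (0 : EuclideanSpace ℝ (Fin d)) 1))⁻¹ *
      (d * volume (ball (0 : EuclideanSpace ℝ (Fin d)) 1)) = 1 :=
    ENNReal.inv_mul_cancel
      (mul_ne_zero (Nat.cast_ne_zero.2 hd) (measure_ball_pos _ _ one_pos).ne')
      (ENNReal.mul_ne_top (ENNReal.natCast_ne_top d) measure_ball_lt_top.ne)
  rw [uniformSphere, Measure.smul_apply, smul_eq_mul, Measure.toSphere_apply' _ hS,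
    Measure.toSphere_apply_univ, finrank_euclideanSpace_fin]
  rw [mul_assoc, mul_right_comm (d : ENNReal), ← mul_assoc, hmass, one_mul]

lemma uniformSphere_orthogonal {z : EuclideanSpace ℝ (Fin d)} (hz : z ≠ 0) :
    uniformSphere d {v | ⟪(v : EuclideanSpace ℝ (Fin d)), z⟫ = 0} = 0 := by
  set S := {v : sphere (0 : EuclideanSpace ℝ (Fin d)) 1 | ⟪(v : EuclideanSpace ℝ (Fin d)), z⟫ = 0}
  have hS : MeasurableSet S := (isClosed_eq (by fun_prop) (by fun_prop)).measurableSet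
  have hcone : (Set.Ioo (0 : ℝ) 1 • ((↑) '' S : Set (EuclideanSpace ℝ (Fin d)))) ⊆
      (ℝ ∙ z)ᗮ := by
    rintro _ ⟨r, -, _, ⟨v, hv, rfl⟩, rfl⟩
    exact Submodule.smul_mem _ _ (Submodule.mem_orthogonal_singleton_iff_inner_left.2 hv)
  have hproper : (ℝ ∙ z)ᗮ ≠ ⊤ := by
    simpa [Submodule.orthogonal_eq_top_iff] using hz
  have hnull := measure_mono_null hcone (Measure.addHaar_submodule volume _ hproper)
  rw [← uniformSphere_mul_volume_ball hS] at hnull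
  exact (mul_eq_zero.1 hnull).resolve_right (measure_ball_pos _ _ one_pos).ne'

variable {w : EuclideanSpace ℝ (Fin d)} {c ρ s : ℝ}

lemma pow_mul_pow_le_uniformSphere_sphericalCap (hw : ‖w‖ = 1) (hs : 0 < s) (hs1 : s ≤ 1)
    (hc : 0 < c) (hc1 : c ≤ 1) (hρ0 : 0 ≤ ρ)
    (hρ : ρ ^ 2 * (s ^ 2 + c ^ 2 * (1 - s ^ 2)) ≤ (1 - ρ) ^ 2 * s ^ 2) :
    c ^ (d - 1) * ρ ^ d ≤ (uniformSphere d).real (sphericalCap w s) := by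
  have : Nontrivial (EuclideanSpace ℝ (Fin d)) := ⟨w, 0, norm_ne_zero_iff.1 (by simp [hw])⟩
  have hvol := measure_mono (μ := volume)
    (axialScaling_image_ball_subset hw hs hs1 ((abs_of_pos hc).trans_le hc1) hρ)
  rw [← uniformSphere_mul_volume_ball (isOpen_sphericalCap w s).measurableSet,
    Measure.addHaar_image_linearMap, det_axialScaling hw hc.ne', Measure.addHaar_ball _ _ hρ0,
    finrank_euclideanSpace_fin, ← mul_assoc,
    ENNReal.mul_le_mul_iff_left (measure_ball_pos _ _ one_pos).ne' measure_ball_lt_top.ne,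
    ← ENNReal.ofReal_mul (abs_nonneg _), abs_of_nonneg (by positivity)] at hvol
  exact (ENNReal.ofReal_le_iff_le_toReal (measure_ne_top _ _)).1 hvol

lemma le_uniformSphere_sphericalCap_of_three_mul_sq_le (hw : ‖w‖ = 1) (hs : 0 < s)
    (hs1 : 3 * s ^ 2 ≤ 1) :
    1 / 3 * (s / √3) ^ (d - 1) ≤ (uniformSphere d).real (sphericalCap w s) := by
  have hsqrt : √3 ^ 2 = 3 := Real.sq_sqrt (by norm_num)
  have hd : d ≠ 0 := by
    rintro rfl
    simp [Subsingleton.elim w 0] at hw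
  calc 1 / 3 * (s / √3) ^ (d - 1) = (√3 * s) ^ (d - 1) * (1 / 3) ^ d := by
        rw [← mul_pow_sub_one hd (1 / 3 : ℝ), mul_left_comm, ← mul_pow]
        congr 2
        field_simp
        rw [hsqrt]
    _ ≤ _ := pow_mul_pow_le_uniformSphere_sphericalCap hw hs (by nlinarith) (by positivity)
        (le_of_sq_le_sq (by rw [mul_pow, hsqrt]; linarith) zero_le_one) (by norm_num) (by
          rw [mul_pow, hsqrt]
          nlinarith [sq_nonneg (s ^ 2)])

lemma div_one_add_pow_le_uniformSphere_sphericalCap (hw : ‖w‖ = 1) (hs : 0 < s) (hs1 : s ≤ 1) :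
    (s / (1 + s)) ^ d ≤ (uniformSphere d).real (sphericalCap w s) := by
  have hball : (s / (1 + s)) ^ 2 * (s ^ 2 + 1 ^ 2 * (1 - s ^ 2)) ≤
      (1 - s / (1 + s)) ^ 2 * s ^ 2 := by
    rw [one_sub_div (by positivity), add_sub_cancel_right, div_pow, div_pow]
    exact le_of_eq (by ring)
  simpa using pow_mul_pow_le_uniformSphere_sphericalCap hw hs hs1 one_pos le_rfl
    (by positivity) hball

/-- The two cases are the flattened ball of radius `1 / 3` for narrow caps and the ball inscribed in
the cone for wide ones. -/
lemma le_uniformSphere_sphericalCap (hd : 2 ≤ d) (hw : ‖w‖ = 1) (hs : 0 < s) (hs1 : s ≤ 1) :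
    7 / 18 * (√2 * s / Real.pi) ^ (d - 1) ≤ (uniformSphere d).real (sphericalCap w s) := by
  obtain ⟨n, rfl⟩ := Nat.exists_eq_add_of_le' hd
  have hconst : √2 * s / Real.pi ≤ 12 / 25 * s := by
    have hsqrt : √2 / Real.pi ≤ 12 / 25 := by
      rw [div_le_iff₀ Real.pi_pos]
      linarith [Real.sqrt_two_lt_three_halves, Real.pi_gt_d2]
    rw [mul_div_right_comm]
    exact mul_le_mul_of_nonneg_right hsqrt hs.le
  have hpow : 7 / 18 * (√2 * s / Real.pi) ^ (n + 1) ≤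
      7 / 18 * (12 / 25 * s) * (12 / 25 * s) ^ n := by
    rw [mul_assoc, ← pow_succ']
    gcongr
  refine hpow.trans ?_
  rcases le_total s (1 / 2) with hnarrow | hwide
  · refine le_trans ?_ (le_uniformSphere_sphericalCap_of_three_mul_sq_le hw hs (by nlinarith))
    have hsqrt : 4 / 7 * s ≤ s / √3 := by
      have hinv : 4 / 7 ≤ (√3)⁻¹ := by
        rw [le_inv_comm₀ (by norm_num) (by positivity), Real.sqrt_le_left (by norm_num)]
        norm_num
      rw [div_eq_inv_mul s]
      exact mul_le_mul_of_nonneg_right hinv hs.le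
    change _ ≤ 1 / 3 * (s / √3) ^ (n + 1)
    rw [pow_succ', ← mul_assoc (1 / 3)]
    have hbase : 12 / 25 * s ≤ s / √3 := by linarith
    exact mul_le_mul (by linarith) (pow_le_pow_left₀ (by positivity) hbase n)
      (by positivity) (by positivity)
  · refine le_trans ?_ (div_one_add_pow_le_uniformSphere_sphericalCap hw hs hs1)
    have hbase : 12 / 25 * s ≤ s / (1 + s) := by
      rw [le_div_iff₀ (by positivity)]
      nlinarith
    have hsq : 7 / 18 * (12 / 25 * s) ≤ (s / (1 + s)) ^ 2 := by
      rw [div_pow, le_div_iff₀ (by positivity)]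
      nlinarith
    rw [pow_add, mul_comm]
    gcongr

end UniformSphere

section NormalDirections

variable {d N : ℕ} {x : Fin N → EuclideanSpace ℝ (Fin d)}

lemma measurableSet_normalDirections (x : Fin N → EuclideanSpace ℝ (Fin d)) (i : Fin N) :
    MeasurableSet (normalDirections x i) := by
  rw [normalDirections, Set.ofPred_forall]
  exact .iInter fun j => (isClosed_le (by fun_prop) (by fun_prop)).measurableSet

lemma uniformSphere_inter_normalDirections (hx : Function.Injective x) {i j : Fin N}
    (hij : i ≠ j) : uniformSphere d (normalDirections x i ∩ normalDirections x j) = 0 := by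
  refine measure_mono_null (fun v hv => ?_) (uniformSphere_orthogonal (sub_ne_zero.2 (hx.ne hij)))
  rw [Set.mem_ofPred_eq, inner_sub_right, sub_eq_zero]
  exact le_antisymm (hv.2 i) (hv.1 j)

lemma curvature_nonneg (x : Fin N → EuclideanSpace ℝ (Fin d)) (i : Fin N) :
    0 ≤ curvature x i := measureReal_nonneg

lemma sum_curvature_eq_measureReal_biUnion (hx : Function.Injective x) (T : Finset (Fin N)) :
    ∑ j ∈ T, curvature x j = (uniformSphere d).real (⋃ j ∈ T, normalDirections x j) :=
  (measureReal_biUnion_finset₀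
    (fun _ _ _ _ hij => uniformSphere_inter_normalDirections hx hij)
    fun j _ => (measurableSet_normalDirections x j).nullMeasurableSet).symm

end NormalDirections

section SupportingDirections

variable {E : Type*} [NormedAddCommGroup E] [InnerProductSpace ℝ E]

lemma exists_norm_eq_one_infDist_le_inner_sub {K : Set E} (hK : IsComplete K) (hKc : Convex ℝ K)
    (hne : K.Nonempty) {y : E} (hy : 0 < infDist y K) :
    ∃ w : E, ‖w‖ = 1 ∧ ∀ p ∈ K, infDist y K ≤ ⟪w, y - p⟫ := by
  obtain ⟨z, hz, hyz⟩ := exists_norm_eq_iInf_of_complete_convex hne hK hKc y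
  have hvar := (norm_eq_iInf_iff_real_inner_le_zero hKc hz).1 hyz
  have hle : infDist y K ≤ ‖y - z‖ := (infDist_le_dist_of_mem hz).trans_eq (dist_eq_norm y z)
  have hpos : 0 < ‖y - z‖ := hy.trans_le hle
  refine ⟨‖y - z‖⁻¹ • (y - z), by simp [norm_smul, hpos.ne'], fun p hp => hle.trans ?_⟩
  rw [real_inner_smul_left, ← div_eq_inv_mul, le_div_iff₀ hpos, ← sub_add_sub_cancel y z p,
    inner_add_right, real_inner_self_eq_norm_mul_norm, ← neg_sub p z, inner_neg_right]
  linarith [hvar p hp]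

lemma exists_inner_le_of_mem_convexHull_range {ι : Type*} {p : ι → E} {y : E}
    (hy : y ∈ convexHull ℝ (Set.range p)) (w : E) : ∃ i, ⟪w, y⟫ ≤ ⟪w, p i⟫ := by
  obtain ⟨_, ⟨i, rfl⟩, hi⟩ :=
    ((innerₛₗ ℝ w).convexOn convex_univ).exists_ge_of_mem_convexHull
      (Set.subset_univ (Set.range p)) hy
  exact ⟨i, hi⟩

lemma exists_infDist_convexHull_le_inner_sub {ι : Type*} {p : ι → E} {T : Finset ι}
    (hT : T.Nonempty) {y : E} (hy : y ∈ convexHull ℝ (Set.range p))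
    (hpos : 0 < infDist y (convexHull ℝ (p '' T))) :
    ∃ w : E, ‖w‖ = 1 ∧ ∃ i, ∀ j ∈ T, infDist y (convexHull ℝ (p '' T)) ≤ ⟪w, p i - p j⟫ := by
  obtain ⟨w, hw, hsep⟩ := exists_norm_eq_one_infDist_le_inner_sub
    ((T.finite_toSet.image p).isCompact_convexHull ℝ).isComplete (convex_convexHull ℝ _)
    (hT.to_set.image p).convexHull hpos
  obtain ⟨i, hi⟩ := exists_inner_le_of_mem_convexHull_range hy w
  refine ⟨w, hw, i, fun j hj => ?_⟩
  have hj' := hsep (p j) (subset_convexHull ℝ _ ⟨j, hj, rfl⟩)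
  rw [inner_sub_right] at hj' ⊢
  linarith

end SupportingDirections

section HausdorffDistance

lemma infDist_convexHull_image_le {F ι : Type*} [SeminormedAddCommGroup F] [NormedSpace ℝ F]
    {p : ι → F} {T : Set ι} (hT : T.Nonempty) {R : ℝ} (hR : ∀ i, ‖p i‖ ≤ R) {y : F}
    (hy : y ∈ convexHull ℝ (Set.range p)) :
    infDist y (convexHull ℝ (p '' T)) ≤ 2 * R := by
  obtain ⟨j, hj⟩ := hT
  have hball : Set.range p ⊆ closedBall 0 R :=
    Set.range_subset_iff.2 fun i => mem_closedBall_zero_iff.2 (hR i)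
  have hyR := mem_closedBall_zero_iff.1 (convexHull_min hball (convex_closedBall 0 R) hy)
  calc infDist y (convexHull ℝ (p '' T)) ≤ dist y (p j) :=
        infDist_le_dist_of_mem (subset_convexHull ℝ _ ⟨j, hj, rfl⟩)
    _ ≤ ‖y‖ + ‖p j‖ := dist_le_norm_add_norm y (p j)
    _ ≤ 2 * R := by linarith [hR j]

variable {d N : ℕ} {x : Fin N → EuclideanSpace ℝ (Fin d)} {T : Finset (Fin N)} {R η : ℝ}

/-- Around a direction in which some data point exceeds all the points of `T` by the distance from
`y` to their hull, a whole cap of directions has no maximizer in `T`. -/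
lemma pow_infDist_le_one_sub_sum_curvature (hd : 2 ≤ d) (hx : Function.Injective x)
    (hT : T.Nonempty) (hR : ∀ i, ‖x i‖ ≤ R) {y : EuclideanSpace ℝ (Fin d)}
    (hy : y ∈ convexHull ℝ (Set.range x)) (hpos : 0 < infDist y (convexHull ℝ (x '' T))) :
    7 / 18 * (√2 * (infDist y (convexHull ℝ (x '' T)) / (2 * R)) / Real.pi) ^ (d - 1) ≤
      1 - ∑ j ∈ T, curvature x j := by
  obtain ⟨w, hw, i, hi⟩ := exists_infDist_convexHull_le_inner_sub hT hy hpos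
  have hle := infDist_convexHull_image_le hT.to_set hR hy
  set r := infDist y (convexHull ℝ (x '' T))
  have hR0 : 0 < 2 * R := hpos.trans_le hle
  have hdisj : Disjoint (sphericalCap w (r / (2 * R))) (⋃ j ∈ T, normalDirections x j) := by
    rw [Set.disjoint_iUnion₂_right]
    refine fun j hj => Set.disjoint_left.2 fun v hv hvj => ?_
    have hnorm : ‖x i - x j‖ ≤ 2 * R := by linarith [norm_sub_le (x i) (x j), hR i, hR j]
    have hcone : r / (2 * R) * ‖x i - x j‖ ≤ ⟪w, x i - x j⟫ := by
      refine (mul_le_mul_of_nonneg_left hnorm (by positivity)).trans ?_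
      rw [div_mul_cancel₀ r hR0.ne']
      exact hi j hj
    have hlt := inner_pos_of_mem_sphericalCap hw (by positivity) hv (hpos.trans_le (hi j hj)) hcone
    rw [inner_sub_right] at hlt
    linarith [hvj i]
  have hunion := measureReal_union (μ := uniformSphere d) hdisj
    (T.measurableSet_biUnion fun j _ => measurableSet_normalDirections x j)
    (measure_ne_top _ _) (measure_ne_top _ _)
  have hcap := le_uniformSphere_sphericalCap hd hw (div_pos hpos hR0) (div_le_one_of_le₀ hle hR0.le)
  rw [sum_curvature_eq_measureReal_biUnion hx]
  linarith [measureReal_le_one (μ := uniformSphere d)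
    (s := sphericalCap w (r / (2 * R)) ∪ ⋃ j ∈ T, normalDirections x j)]

lemma infDist_convexHull_image_le_of_sum_curvature (hd : 2 ≤ d) (hx : Function.Injective x)
    (hT : T.Nonempty) (hR : ∀ i, ‖x i‖ ≤ R) (hη : 0 ≤ η)
    (hsum : 1 - 7 / 18 * η ≤ ∑ j ∈ T, curvature x j) {y : EuclideanSpace ℝ (Fin d)}
    (hy : y ∈ convexHull ℝ (Set.range x)) :
    infDist y (convexHull ℝ (x '' T)) ≤ √2 * Real.pi * η ^ (1 / ((d : ℝ) - 1)) * R := by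
  have hR0 : 0 ≤ R := (norm_nonneg _).trans (hR hT.choose)
  rcases le_or_gt (infDist y (convexHull ℝ (x '' T))) 0 with hzero | hpos
  · exact hzero.trans (by positivity)
  have hle := infDist_convexHull_image_le hT.to_set hR hy
  have hpow := pow_infDist_le_one_sub_sum_curvature hd hx hT hR hy hpos
  set r := infDist y (convexHull ℝ (x '' T))
  have hRpos : 0 < R := by linarith
  have hroot : √2 * (r / (2 * R)) / Real.pi ≤ η ^ (1 / ((d : ℝ) - 1)) := by
    rw [one_div, ← Nat.cast_pred (by omega), Real.le_rpow_inv_iff_of_pos (by positivity) hη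
      (by rw [Nat.cast_pos]; omega), Real.rpow_natCast]
    linarith
  have hsqrt : √2 * √2 = 2 := Real.mul_self_sqrt zero_le_two
  calc r = √2 * Real.pi * (√2 * (r / (2 * R)) / Real.pi) * R := by
        field_simp
        linarith
    _ ≤ _ := by gcongr

lemma hausdorffDist_convexHull_le_of_sum_curvature (hd : 2 ≤ d) (hx : Function.Injective x)
    (hT : T.Nonempty) (hR : ∀ i, ‖x i‖ ≤ R) (hη : 0 ≤ η)
    (hsum : 1 - 7 / 18 * η ≤ ∑ j ∈ T, curvature x j) :
    hausdorffDist (convexHull ℝ (x '' T)) (convexHull ℝ (Set.range x)) ≤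
      min (√2 * Real.pi * η ^ (1 / ((d : ℝ) - 1))) 2 * R := by
  have hR0 : 0 ≤ R := (norm_nonneg _).trans (hR hT.choose)
  refine hausdorffDist_le_of_infDist (by positivity) (fun y hy => ?_) fun y hy => ?_
  · rw [infDist_zero_of_mem (convexHull_mono (Set.image_subset_range x T) hy)]
    positivity
  · rw [min_mul_of_nonneg _ _ hR0]
    exact le_min (infDist_convexHull_image_le_of_sum_curvature hd hx hT hR hη hsum hy)
      (infDist_convexHull_image_le hT.to_set hR hy)

end HausdorffDistance

section GeneralPosition

variable {E : Type*} [NormedAddCommGroup E] [NormedSpace ℝ E] [FiniteDimensional ℝ E] {ι : Type*}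
  {p : ι → E}

lemma affineIndependent_of_nonempty_interior_convexHull [Fintype ι]
    (hcard : Fintype.card ι = finrank ℝ E + 1)
    (h : (interior (convexHull ℝ (Set.range p))).Nonempty) : AffineIndependent ℝ p := by
  rw [affineIndependent_iff_finrank_vectorSpan_eq ℝ p hcard, ← direction_affineSpan,
    interior_convexHull_nonempty_iff_affineSpan_eq_top.1 h, AffineSubspace.direction_top,
    finrank_top]

lemma injective_of_nonempty_interior_convexHull_image [Finite ι]
    (hpos : 0 < finrank ℝ E) (hcard : finrank ℝ E < Nat.card ι)
    (h : ∀ D : Finset ι, finrank ℝ E < D.card → (interior (convexHull ℝ (p '' D))).Nonempty) :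
    Function.Injective p := by
  classical
  have := Fintype.ofFinite ι
  intro i j hij
  have hpair : ({i, j} : Finset ι).card ≤ finrank ℝ E + 1 :=
    Finset.card_le_two.trans (Nat.succ_le_succ hpos)
  obtain ⟨D, hD, hDcard⟩ := Finset.exists_superset_card_eq hpair
    (by rwa [← Nat.card_eq_fintype_card])
  have hindep : AffineIndependent ℝ fun k : D => p k :=
    affineIndependent_of_nonempty_interior_convexHull (by rw [Fintype.card_coe, hDcard])
      (by simpa [Set.image_eq_range] using h D (by omega))
  have hinj := hindep.injective
  exact congrArg Subtype.val (@hinj ⟨i, hD (by simp)⟩ ⟨j, hD (by simp)⟩ hij)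

end GeneralPosition

section Cutoff

variable {d N M : ℕ}

/-- The first `k` indices in the enumeration `σ`. The output of the algorithm is
`leadingIndices σ L`, and the `k` largest curvatures are those of `leadingIndices τ k` for a
permutation `τ` that sorts the curvatures. -/
def leadingIndices (σ : Equiv.Perm (Fin N)) (k : ℕ) : Finset (Fin N) :=
  (Finset.univ.filter fun j : Fin N => (j : ℕ) < k).map σ.toEmbedding

lemma card_leadingIndices (σ : Equiv.Perm (Fin N)) (k : ℕ) :
    (leadingIndices σ k).card = min N k := by
  rw [leadingIndices, Finset.card_map, Fin.card_filter_val_lt]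

lemma apply_mem_leadingIndices {σ : Equiv.Perm (Fin N)} {k : ℕ} {j : Fin N} :
    σ j ∈ leadingIndices σ k ↔ (j : ℕ) < k := by
  simp [leadingIndices]

lemma leadingIndices_mono (σ : Equiv.Perm (Fin N)) : Monotone (leadingIndices σ) :=
  fun _ _ hkl =>
    Finset.map_subset_map.2 (Finset.monotone_filter_right _ fun _ _ h => h.trans_le hkl)

lemma sum_range_sortedCurvature (x : Fin N → EuclideanSpace ℝ (Fin d)) (k : ℕ) :
    ∑ i ∈ Finset.range k, sortedCurvature x i =
      ∑ j ∈ leadingIndices (Tuple.sort fun i => -curvature x i) k, curvature x j := by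
  rw [leadingIndices, Finset.sum_map]
  refine (Finset.sum_of_injOn Fin.val Fin.val_injective.injOn (fun j hj => by simpa using hj)
    (fun i hi hiN => ?_) fun j _ => ?_).symm
  · exact dif_neg fun h => hiN ⟨⟨i, h⟩, by simpa using hi, rfl⟩
  · simp [sortedCurvature]

lemma sum_le_sum_of_card_eq_of_forall_le {ι R : Type*} [AddCommMonoid R] [PartialOrder R]
    [IsOrderedAddMonoid R] {f : ι → R} {S I : Finset ι} (hcard : S.card = I.card)
    (hf : ∀ i ∈ I, ∀ j ∉ I, f j ≤ f i) : ∑ j ∈ S, f j ≤ ∑ i ∈ I, f i := by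
  classical
  let exchange : ↥(S \ I) ≃ ↥(I \ S) := Finset.equivOfCardEq (Finset.card_sdiff_comm hcard)
  rw [← Finset.sum_inter_add_sum_sdiff S I, ← Finset.sum_inter_add_sum_sdiff I S,
    Finset.inter_comm I S, ← Finset.sum_coe_sort (S \ I), ← Finset.sum_coe_sort (I \ S),
    ← exchange.sum_comp]
  exact add_le_add le_rfl (Finset.sum_le_sum fun j _ =>
    hf _ (Finset.mem_sdiff.1 (exchange j).2).1 _ (Finset.mem_sdiff.1 j.2).2)

lemma sum_le_sum_leadingIndices {f : Fin N → ℝ} {σ : Equiv.Perm (Fin N)}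
    (hσ : Antitone (f ∘ σ)) {k : ℕ} {S : Finset (Fin N)} (hS : S.card = min N k) :
    ∑ j ∈ S, f j ≤ ∑ j ∈ leadingIndices σ k, f j := by
  refine sum_le_sum_of_card_eq_of_forall_le (hS.trans (card_leadingIndices σ k).symm) ?_
  intro i hi j hj
  rw [← σ.apply_symm_apply i, apply_mem_leadingIndices] at hi
  rw [← σ.apply_symm_apply j, apply_mem_leadingIndices, not_lt] at hj
  simpa using hσ (Fin.le_def.2 (hi.le.trans hj))

lemma cutoff_eq_max_sInf (d : ℕ) (η : ℝ) (u : Fin M → Fin N) (σ : Equiv.Perm (Fin N)) :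
    cutoff d η u σ =
      max (sInf {ℓ : ℕ | 1 - η / 3 < ∑ j ∈ leadingIndices σ ℓ, (hitCount u j : ℝ) / M})
        (d + 1) := by
  simp only [cutoff, leadingIndices, Finset.sum_map, Equiv.coe_toEmbedding, ← Finset.sum_div,
    one_div_mul_eq_div]

lemma exists_le_cutoff_eq_max {η : ℝ} {u : Fin M → Fin N} {σ : Equiv.Perm (Fin N)} {q : ℕ}
    (hq : 1 - η / 3 < ∑ j ∈ leadingIndices σ q, (hitCount u j : ℝ) / M) :
    ∃ ℓ ≤ q, cutoff d η u σ = max ℓ (d + 1) ∧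
      1 - η / 3 < ∑ j ∈ leadingIndices σ ℓ, (hitCount u j : ℝ) / M := by
  have hne : {ℓ : ℕ | 1 - η / 3 < ∑ j ∈ leadingIndices σ ℓ, (hitCount u j : ℝ) / M}.Nonempty :=
    ⟨q, hq⟩
  exact ⟨_, Nat.sInf_le hq, cutoff_eq_max_sInf d η u σ, Nat.sInf_mem hne⟩

lemma abs_sum_sub_sum_le_card_mul {ι : Type*} {f g : ι → ℝ} {S : Finset ι} {t : ℝ}
    (h : ∀ j ∈ S, |f j - g j| ≤ t) : |∑ j ∈ S, f j - ∑ j ∈ S, g j| ≤ S.card * t := by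
  rw [← Finset.sum_sub_distrib, ← nsmul_eq_mul]
  exact (Finset.abs_sum_le_sum_abs _ _).trans (Finset.sum_le_card_nsmul _ _ _ h)

lemma cutoff_le_and_le_sum_curvature {x : Fin N → EuclideanSpace ℝ (Fin d)} {η t : ℝ}
    (hη : 0 < η) {q : ℕ} (hq : 1 - η / 18 ≤ ∑ i ∈ Finset.range q, sortedCurvature x i)
    {u : Fin M → Fin N} {σ : Equiv.Perm (Fin N)} (hσ : Antitone fun j => hitCount u (σ j))
    (ht : 0 ≤ t) (hqt : q * t ≤ η / 18)
    (hclose : ∀ j, |(hitCount u j : ℝ) / M - curvature x j| ≤ t) :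
    cutoff d η u σ ≤ max q (d + 1) ∧
      1 - 7 / 18 * η ≤ ∑ j ∈ leadingIndices σ (cutoff d η u σ), curvature x j := by
  have hsum {τ : Equiv.Perm (Fin N)} {k : ℕ} (hk : k ≤ q) :
      |∑ j ∈ leadingIndices τ k, (hitCount u j : ℝ) / M - ∑ j ∈ leadingIndices τ k, curvature x j| ≤
        η / 18 := by
    refine (abs_sum_sub_sum_le_card_mul fun j _ => hclose j).trans (le_trans ?_ hqt)
    gcongr
    exact (card_leadingIndices τ k).trans_le ((min_le_right N k).trans hk)
  rw [sum_range_sortedCurvature] at hq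
  have hfreq : 1 - η / 3 < ∑ j ∈ leadingIndices σ q, (hitCount u j : ℝ) / M := by
    have hanti : Antitone ((fun j => (hitCount u j : ℝ) / M) ∘ σ) := fun i j hij =>
      div_le_div_of_nonneg_right (Nat.cast_le.2 (hσ hij)) M.cast_nonneg
    linarith [(abs_le.1 (hsum (τ := Tuple.sort fun i => -curvature x i) le_rfl)).1,
      sum_le_sum_leadingIndices hanti
        (card_leadingIndices (Tuple.sort fun i => -curvature x i) q)]
  obtain ⟨ℓ, hℓq, hcut, hℓ⟩ := exists_le_cutoff_eq_max (d := d) hfreq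
  rw [hcut]
  refine ⟨max_le_max_right _ hℓq, ?_⟩
  calc 1 - 7 / 18 * η ≤ ∑ j ∈ leadingIndices σ ℓ, curvature x j := by
        linarith [(abs_le.1 (hsum (τ := σ) hℓq)).2]
    _ ≤ ∑ j ∈ leadingIndices σ (max ℓ (d + 1)), curvature x j :=
        Finset.sum_le_sum_of_subset_of_nonneg (leadingIndices_mono σ (le_max_left _ _))
          fun j _ _ => curvature_nonneg x j

end Cutoff

section Concentration

variable {Ω α ι : Type*} [MeasurableSpace Ω] [MeasurableSpace α] [Fintype ι] {P : Measure Ω}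
  {μ : Measure α}

lemma measureReal_le_abs_le_of_hasSubgaussianMGF {X : Ω → ℝ} {c : NNReal}
    (hX : HasSubgaussianMGF X c P) {ε : ℝ} (hε : 0 ≤ ε) :
    P.real {ω | ε ≤ |X ω|} ≤ 2 * Real.exp (-ε ^ 2 / (2 * c)) := by
  have hupper : P.real {ω | ε ≤ X ω} ≤ Real.exp (-ε ^ 2 / (2 * c)) := hX.measure_ge_le hε
  have hlower : P.real {ω | ε ≤ -X ω} ≤ Real.exp (-ε ^ 2 / (2 * c)) := hX.neg.measure_ge_le hε
  simp only [le_abs, Set.ofPred_or]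
  linarith [measureReal_union_le (μ := P) {ω | ε ≤ X ω} {ω | ε ≤ -X ω}]

lemma hasSubgaussianMGF_indicator_sub_measureReal [IsProbabilityMeasure P] {Y : Ω → α}
    (hY : HasLaw Y μ P) {S : Set α} (hS : MeasurableSet S) :
    HasSubgaussianMGF (fun ω => S.indicator (1 : α → ℝ) (Y ω) - μ.real S) (1 / 4) P := by
  have hmeas : Measurable (S.indicator (1 : α → ℝ)) := measurable_one.indicator hS
  have hmean : ∫ ω, S.indicator (1 : α → ℝ) (Y ω) ∂P = μ.real S :=
    (hY.integral_comp hmeas.aestronglyMeasurable).trans (integral_indicator_one hS)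
  have hbound : ∀ ω, S.indicator (1 : α → ℝ) (Y ω) ∈ Set.Icc 0 1 := fun ω =>
    ⟨Set.indicator_nonneg (fun _ _ => zero_le_one) _, Set.indicator_le_self' (by simp) _⟩
  have h := hasSubgaussianMGF_of_mem_Icc (hmeas.comp_aemeasurable hY.aemeasurable)
    (.of_forall hbound)
  have hparam : (‖(1 : ℝ) - 0‖₊ / 2) ^ 2 = 1 / 4 := by
    rw [sub_zero, nnnorm_one]
    norm_num
  rwa [hparam, Function.comp_def, hmean] at h

/-- The fraction of the points `y i` that lie in `S`, written with indicators so that Hoeffding's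
inequality applies to the sum. It is `0` for an empty index type. -/
noncomputable def empiricalFrequency (y : ι → α) (S : Set α) : ℝ :=
  (∑ i, S.indicator 1 (y i)) / Fintype.card ι

lemma measureReal_le_abs_empiricalFrequency_sub_le [IsProbabilityMeasure P] {Y : ι → Ω → α}
    (hlaw : ∀ i, HasLaw (Y i) μ P) (hindep : iIndepFun Y P) {S : Set α} (hS : MeasurableSet S)
    {t : ℝ} (ht : 0 ≤ t) :
    P.real {ω | t ≤ |empiricalFrequency (Y · ω) S - μ.real S|} ≤
      2 * Real.exp (-(2 * Fintype.card ι * t ^ 2)) := by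
  rcases isEmpty_or_nonempty ι with hι | hι
  · simpa using measureReal_le_one.trans one_le_two
  have hn : (0 : ℝ) < Fintype.card ι := Nat.cast_pos.2 Fintype.card_pos
  have hscale (ω : Ω) : ∑ i, (S.indicator (1 : α → ℝ) (Y i ω) - μ.real S) =
      Fintype.card ι * (empiricalFrequency (Y · ω) S - μ.real S) := by
    rw [Finset.sum_sub_distrib, Finset.sum_const, Finset.card_univ, nsmul_eq_mul, mul_sub,
      empiricalFrequency, mul_div_cancel₀ _ hn.ne']
  have hsubG := HasSubgaussianMGF.sum_of_iIndepFun (s := Finset.univ)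
    (hindep.comp (fun _ y => S.indicator (1 : α → ℝ) y - μ.real S)
      fun _ => (measurable_one.indicator hS).sub_const _)
    fun i _ => hasSubgaussianMGF_indicator_sub_measureReal (hlaw i) hS
  have htail := measureReal_le_abs_le_of_hasSubgaussianMGF hsubG (mul_nonneg hn.le ht)
  simp only [Function.comp_apply, hscale, abs_mul, abs_of_pos hn, mul_le_mul_iff_right₀ hn] at htail
  refine htail.trans_eq ?_
  congr 2
  simp only [Finset.sum_const, Finset.card_univ, nsmul_eq_mul]
  push_cast
  field_simp
  norm_num

lemma measureReal_exists_le_abs_empiricalFrequency_sub_le [IsProbabilityMeasure P] {κ : Type*}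
    [Fintype κ] {Y : ι → Ω → α} (hlaw : ∀ i, HasLaw (Y i) μ P) (hindep : iIndepFun Y P)
    {S : κ → Set α} (hS : ∀ j, MeasurableSet (S j)) {t : ℝ} (ht : 0 ≤ t) :
    P.real {ω | ∃ j, t ≤ |empiricalFrequency (Y · ω) (S j) - μ.real (S j)|} ≤
      2 * Fintype.card κ * Real.exp (-(2 * Fintype.card ι * t ^ 2)) := by
  rw [Set.ofPred_exists]
  calc _ ≤ ∑ j, P.real {ω | t ≤ |empiricalFrequency (Y · ω) (S j) - μ.real (S j)|} :=
        measureReal_iUnion_fintype_le _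
    _ ≤ ∑ _j : κ, 2 * Real.exp (-(2 * Fintype.card ι * t ^ 2)) :=
        Finset.sum_le_sum fun j _ =>
          measureReal_le_abs_empiricalFrequency_sub_le hlaw hindep (hS j) ht
    _ = _ := by
        rw [Finset.sum_const, Finset.card_univ, nsmul_eq_mul]
        ring

lemma one_sub_measureReal_le_of_ae [IsProbabilityMeasure P] {A B : Set Ω}
    (h : ∀ᵐ ω ∂P, ω ∉ A → ω ∈ B) : 1 - P.real A ≤ P.real B := by
  have hcover : (Set.univ : Set Ω) ≤ᵐ[P] (A ∪ B : Set Ω) := by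
    filter_upwards [h] with ω hω _ using or_iff_not_imp_left.2 hω
  have hone : 1 ≤ P.real (A ∪ B) :=
    probReal_univ.symm.trans_le (ENNReal.toReal_mono (measure_ne_top _ _) (measure_mono_ae hcover))
  linarith [measureReal_union_le (μ := P) A B]

end Concentration

section Output

variable {d N M : ℕ} {x : Fin N → EuclideanSpace ℝ (Fin d)}

lemma ae_eq_of_mem_normalDirections (hx : Function.Injective x) :
    ∀ᵐ v ∂uniformSphere d, ∀ j k, v ∈ normalDirections x j → v ∈ normalDirections x k → j = k := by
  refine ae_all_iff.2 fun j => ae_all_iff.2 fun k => ?_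
  rcases eq_or_ne j k with hjk | hjk
  · exact .of_forall fun _ _ _ => hjk
  · filter_upwards [measure_eq_zero_iff_ae_notMem.1 (uniformSphere_inter_normalDirections hx hjk)]
      with v hv hj hk using absurd ⟨hj, hk⟩ hv

lemma hitCount_div_eq_empiricalFrequency
    {y : Fin M → sphere (0 : EuclideanSpace ℝ (Fin d)) 1} {u : Fin M → Fin N}
    (hu : ∀ i, y i ∈ normalDirections x (u i))
    (hunique : ∀ i j k, y i ∈ normalDirections x j → y i ∈ normalDirections x k → j = k)
    (j : Fin N) : (hitCount u j : ℝ) / M = empiricalFrequency y (normalDirections x j) := by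
  classical
  have hmem (i : Fin M) : y i ∈ normalDirections x j ↔ u i = j :=
    ⟨hunique i _ _ (hu i), fun h => h ▸ hu i⟩
  simp only [empiricalFrequency, hitCount, Set.indicator_apply, hmem, Pi.one_apply,
    Finset.sum_boole, Fintype.card_fin]

lemma card_le_and_hausdorffDist_le_of_isOutput (hd : 2 ≤ d) (hN : 0 < N)
    (hx : Function.Injective x) {η t : ℝ} (hη : 0 < η) {q : ℕ}
    (hq : 1 - η / 18 ≤ ∑ i ∈ Finset.range q, sortedCurvature x i) (ht : 0 ≤ t)
    (hqt : q * t ≤ η / 18) {y : Fin M → sphere (0 : EuclideanSpace ℝ (Fin d)) 1}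
    (hunique : ∀ i j k, y i ∈ normalDirections x j → y i ∈ normalDirections x k → j = k)
    (hclose : ∀ j, |empiricalFrequency y (normalDirections x j) - curvature x j| ≤ t)
    {T : Finset (Fin N)} (hT : IsOutput x η y T) :
    T.card ≤ max q (d + 1) ∧
      hausdorffDist (convexHull ℝ (x '' T)) (convexHull ℝ (Set.range x)) ≤
        min (√2 * Real.pi * η ^ (1 / ((d : ℝ) - 1))) 2 * ⨆ i, ‖x i‖ := by
  obtain ⟨u, σ, hu, hσ, rfl⟩ := hT
  obtain ⟨hcutoff, hcurvature⟩ := cutoff_le_and_le_sum_curvature hη hq hσ ht hqt fun j => by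
    rw [hitCount_div_eq_empiricalFrequency hu hunique]
    exact hclose j
  have hcard := card_leadingIndices σ (cutoff d η u σ)
  have hne : (leadingIndices σ (cutoff d η u σ)).Nonempty := by
    rw [← Finset.card_pos, hcard]
    exact lt_min hN (Nat.succ_pos d |>.trans_le (le_max_right _ _))
  exact ⟨hcard.trans_le ((min_le_right _ _).trans hcutoff),
    hausdorffDist_convexHull_le_of_sum_curvature hd hx hne
      (le_ciSup (Set.finite_range fun i => ‖x i‖).bddAbove) hη.le hcurvature⟩

end Output

lemma two_mul_mul_exp_le_of_mul_log_le {η δ : ℝ} (hη : η ≠ 0) (hδ : 0 < δ) {q N : ℕ} (hq : q ≠ 0)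
    (hN : 0 < N) {a m : ℝ} (hm : 0 ≤ m)
    (h : max (324 * (q : ℝ) ^ 2 / η ^ 2) a * Real.log (3 * (N : ℝ) / √δ) ≤ m) :
    2 * N * Real.exp (-(2 * m * (η / (18 * q)) ^ 2)) ≤ δ := by
  set t := η / (18 * q) with ht
  set l := Real.log (3 * (N : ℝ) / √δ) with hl
  have hN1 : (1 : ℝ) ≤ N := Nat.one_le_cast.2 hN
  have hlog : l ≤ m * t ^ 2 := by
    rcases le_total l 0 with hl0 | hl0
    · exact hl0.trans (by positivity)
    · have hinv : 324 * (q : ℝ) ^ 2 / η ^ 2 * t ^ 2 = 1 := by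
        rw [ht]
        field_simp
        norm_num
      calc l = 324 * (q : ℝ) ^ 2 / η ^ 2 * l * t ^ 2 := by rw [mul_right_comm, hinv, one_mul]
        _ ≤ m * t ^ 2 := by
          gcongr
          exact (mul_le_mul_of_nonneg_right (le_max_left _ _) hl0).trans h
  have hexp : 3 * N ≤ Real.exp (m * t ^ 2) * √δ := by
    rwa [hl, Real.log_le_iff_le_exp (by positivity), div_le_iff₀ (Real.sqrt_pos.2 hδ)] at hlog
  have hsq : (3 * N) ^ 2 ≤ δ * Real.exp (m * t ^ 2) ^ 2 := by
    have h := pow_le_pow_left₀ (by positivity) hexp 2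
    rwa [mul_pow _ √δ, Real.sq_sqrt hδ.le, mul_comm _ δ] at h
  rw [mul_assoc 2 m, Real.exp_neg, ← Nat.cast_ofNat, Real.exp_nat_mul, Nat.cast_ofNat,
    ← div_eq_mul_inv, div_le_iff₀ (by positivity)]
  nlinarith
end ApproxHull

theorem mainTheorem2_general {d N M : ℕ} (hd : 2 ≤ d) (hN : 0 < N)
    {x : Fin N → EuclideanSpace ℝ (Fin d)} (hx : Function.Injective x) {η : ℝ} (hη : 0 < η)
    {q : ℕ} (hq : 1 ≤ q)
    (hqsum : 1 - η / 18 ≤ ∑ i ∈ Finset.range q, ApproxHull.sortedCurvature x i)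
    {Ω : Type*} [MeasurableSpace Ω] (P : Measure Ω) [IsProbabilityMeasure P]
    {v : Fin M → Ω → Metric.sphere (0 : EuclideanSpace ℝ (Fin d)) 1}
    (hv_law : ∀ i, HasLaw (v i) (ApproxHull.uniformSphere d) P)
    (hv_indep : iIndepFun v P) :
    1 - 2 * N * Real.exp (-(2 * M * (η / (18 * q)) ^ 2)) ≤ P.real {ω | ∀ T : Finset (Fin N),
      ApproxHull.IsOutput x η (fun i => v i ω) T →
        T.card ≤ max q (d + 1) ∧
        Metric.hausdorffDist (convexHull ℝ (x '' (T : Set (Fin N))))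
            (convexHull ℝ (Set.range x)) ≤
          min (√2 * Real.pi * η ^ (1 / ((d : ℝ) - 1))) 2 * ⨆ i, ‖x i‖} := by
  have hunion := ApproxHull.measureReal_exists_le_abs_empiricalFrequency_sub_le hv_law hv_indep
    (ApproxHull.measurableSet_normalDirections x) (show 0 ≤ η / (18 * q) by positivity)
  rw [Fintype.card_fin, Fintype.card_fin] at hunion
  refine (sub_le_sub_left hunion 1).trans (ApproxHull.one_sub_measureReal_le_of_ae ?_)
  have hunique : ∀ᵐ ω ∂P, ∀ i j k, v i ω ∈ ApproxHull.normalDirections x j →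
      v i ω ∈ ApproxHull.normalDirections x k → j = k :=
    ae_all_iff.2 fun i => ae_of_ae_map (hv_law i).aemeasurable
      ((hv_law i).map_eq.symm ▸ ApproxHull.ae_eq_of_mem_normalDirections hx)
  filter_upwards [hunique] with ω hω hclose T hT
  simp only [not_exists, not_le] at hclose
  exact ApproxHull.card_le_and_hausdorffDist_le_of_isOutput hd hN hx hη hqsum (by positivity)
    (le_of_eq (by field_simp)) hω (fun j => (hclose j).le) hT

theorem mainTheorem2 {d N M : ℕ} (hd : 2 ≤ d) (hN : d < N)
    (x : Fin N → EuclideanSpace ℝ (Fin d))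
    (hx : ∀ D : Finset (Fin N), d < D.card →
      (interior (convexHull ℝ (x '' (D : Set (Fin N))))).Nonempty)
    (η δ : ℝ) (hη : 0 < η) (hδ : 0 < δ)
    (q : ℕ)
    (hq : IsLeast {j : ℕ | 1 ≤ j ∧
      1 - η / 18 ≤ ∑ i ∈ Finset.range j, ApproxHull.sortedCurvature x i} q)
    (Δ : ℝ)
    (hΔ : Δ = ApproxHull.sortedCurvature x (q - 1) - ApproxHull.sortedCurvature x q)
    (hΔ_pos : 0 < Δ)
    (hM : max (324 * (q : ℝ) ^ 2 / η ^ 2) (4 / Δ ^ 2) * Real.log (3 * (N : ℝ) / √δ) ≤ (M : ℝ))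
    {Ω : Type*} [MeasurableSpace Ω] (P : Measure Ω) [IsProbabilityMeasure P]
    (v : Fin M → Ω → Metric.sphere (0 : EuclideanSpace ℝ (Fin d)) 1)
    (hv_law : ∀ i, HasLaw (v i) (ApproxHull.uniformSphere d) P)
    (hv_indep : iIndepFun v P) :
    1 - δ ≤ P.real {ω | ∀ T : Finset (Fin N),
      ApproxHull.IsOutput x η (fun i => v i ω) T →
        T.card ≤ max q (d + 1) ∧
        Metric.hausdorffDist (convexHull ℝ (x '' (T : Set (Fin N))))
            (convexHull ℝ (Set.range x)) ≤
          min (√2 * Real.pi * η ^ (1 / ((d : ℝ) - 1))) 2 * ⨆ i, ‖x i‖} :=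
  (sub_le_sub_left (ApproxHull.two_mul_mul_exp_le_of_mul_log_le hη.ne' hδ
    (Nat.one_le_iff_ne_zero.1 hq.1.1) (pos_of_gt hN) M.cast_nonneg hM) 1).trans
    (mainTheorem2_general hd (pos_of_gt hN)
      (ApproxHull.injective_of_nonempty_interior_convexHull_image
        (by simpa using pos_of_gt hd) (by simpa using hN) (by simpa using hx))
      hη hq.1.1 hq.1.2 P hv_law hv_indep)
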